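/- \textbf{Proposition (End-to-end Pixel GDP).} Let $d\ge 1$, $T\ge 0$, $\beta_1,\dots,\beta_T\in(0,1)$, $\alpha_t=1-\beta_t$, $\bar\alpha_t=\prod_{u=1}^t\alpha_u$ (so $\bar\alpha_0=1$). For $1\le t\le T$ let $\boldsymbol\epsilon_\theta(\cdot,t):\mathbb R^d\to\mathbb R^d$ be measurable, and let $\Sigma_\theta(\cdot,t)=\mathrm{diag}(\sigma_{t,1}^2(\cdot),\dots,\sigma_{t,d}^2(\cdot))$ be measurable with positive diagonal entries. Let $s\in\mathbb R$ and $\sigma>0$. For an original image $\boldsymbol x\in\mathbb R^d$, the guided denoising algorithm draws $\boldsymbol x_T\sim\mathcal N(0,\mathbf I)$, gives every pixel $j$ the budget $\Lambda_j\gets 1/\sigma^2$, and then does the following for $t=T,T-1,\dots,1$: (1) Put $\hat{\boldsymbol x}_0^t=\frac{1}{\sqrt{\bar\alpha_t}}\big(\boldsymbol x_t-\sqrt{1-\bar\alpha_t}\,\boldsymbol\epsilon_\theta(\boldsymbol x_t,t)\big)$. (2) (Privacy filter and guidance.) For every pixel $j$ put $\Lambda_j'=\Lambda_j-s^2\frac{\bar\alpha_{t-1}(1-\alpha_t)^2}{(1-\bar\alpha_t)^2\,\sigma_{t,j}^2(\boldsymbol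 x_t)}$. If $\Lambda_j'>0$, set $\Lambda_j\gets\Lambda_j'$ and $\hat{\boldsymbol x}^t_{0,j}\gets\hat{\boldsymbol x}^t_{0,j}+s\,(\boldsymbol x_j-\hat{\boldsymbol x}^t_{0,j})$; otherwise leave $\Lambda_j$ and $\hat{\boldsymbol x}^t_{0,j}$ unchanged. (3) Draw $\boldsymbol x_{t-1}\sim\mathcal N\Big(\frac{\sqrt{\bar\alpha_{t-1}}(1-\alpha_t)}{1-\bar\alpha_t}\hat{\boldsymbol x}_0^t+\frac{(1-\bar\alpha_{t-1})\sqrt{\alpha_t}}{1-\bar\alpha_t}\boldsymbol x_t,\ \Sigma_\theta(\boldsymbol x_t,t)\Big)$. The output is $\boldsymbol x_0$; write $M(\boldsymbol x)$ for its law. For probability laws $P,Q$ on one measurable space and $\alpha\in[0,1]$, let $\mathcal T(P,Q)(\alpha)=\inf\{1-\mathbb E_Q\varphi\}$ over all measurable $\varphi$ with values in $[0,1]$ and $\mathbb E_P\varphi\le\alpha$. A mechanism $M$ is $\mu$-GDP for a neighbouring relation if, for all neighbours $\boldsymbol x,\boldsymbol x'$ and all $\alpha\in[0,1]$, $\mathcal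 T(M(\boldsymbol x),M(\boldsymbol x'))(\alpha)\ge \mathcal T(\mathcal N(0,1),\mathcal N(\mu,1))(\alpha)$. Let $i\in\{1,\dots,d\}$ and $r_i\ge0$, and call $\boldsymbol x,\boldsymbol x'\in\mathbb R^d$ neighbours if $\boldsymbol x'_j=\boldsymbol x_j$ for all $j\ne i$ and $|\boldsymbol x'_i-\boldsymbol x_i|\le r_i$. Then the guided denoising algorithm $M$ is $\frac{r_i}{\sigma}$-GDP for this neighbouring relation. -/

import Mathlib

open MeasureTheory ProbabilityTheory
open scoped NNReal

noncomputable section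

/-! ### Gaussian differential privacy -/

/-- The trade-off function of two probability laws `P`, `Q` on `Y`: the smallest type II error
`1 - E_Q φ` of a (randomized) test `φ : Y → [0, 1]` of `P` against `Q` whose type I error `E_P φ`
is at most `α`. -/
def tradeoff {Y : Type*} [MeasurableSpace Y] (P Q : ProbabilityMeasure Y) (α : ℝ) : ℝ :=
  sInf {b : ℝ | ∃ φ : Y → ℝ, Measurable φ ∧ (∀ y, φ y ∈ Set.Icc (0 : ℝ) 1) ∧
    ∫ y, φ y ∂(P : Measure Y) ≤ α ∧ b = 1 - ∫ y, φ y ∂(Q : Measure Y)}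

/-- The normal law on `ℝ` with mean `m` and variance `1`. -/
def unitNormal (m : ℝ) : ProbabilityMeasure ℝ := ⟨gaussianReal m 1, inferInstance⟩

/-- The trade-off curve `G_μ` of `N(0, 1)` against `N(μ, 1)`. -/
def gaussianTradeoff (μ : ℝ) (α : ℝ) : ℝ := tradeoff (unitNormal 0) (unitNormal μ) α

/-- A randomized mechanism `M` is `μ`-GDP for a neighbouring relation if distinguishing the
outputs on two neighbouring inputs is, at every level `α ∈ [0, 1]`, at least as hard as
distinguishing `N(0, 1)` from `N(μ, 1)`. -/
def IsGDP {X Y : Type*} [MeasurableSpace Y] (neigh : X → X → Prop)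
    (M : X → ProbabilityMeasure Y) (μ : ℝ) : Prop :=
  ∀ x x' : X, neigh x x' → ∀ α ∈ Set.Icc (0 : ℝ) 1,
    gaussianTradeoff μ α ≤ tradeoff (M x) (M x') α

/-! ### Images -/

/-- Images with `d` pixels. -/
abbrev Image (d : ℕ) : Type := Fin d → ℝ

/-- `x` and `x'` differ at most in pixel `i`, and there by at most `r`. -/
def PixelNeighbours {d : ℕ} (i : Fin d) (r : ℝ) (x x' : Image d) : Prop :=
  (∀ j, j ≠ i → x' j = x j) ∧ |x' i - x i| ≤ r

/-- The normal law on images with mean `m` and diagonal covariance matrix `diag v`. -/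
def diagGaussian {d : ℕ} (m : Image d) (v : Fin d → ℝ≥0) : Measure (Image d) :=
  Measure.pi fun j => gaussianReal (m j) (v j)

instance diagGaussian_isProbabilityMeasure {d : ℕ} (m : Image d) (v : Fin d → ℝ≥0) :
    IsProbabilityMeasure (diagGaussian m v) := by
  unfold diagGaussian; infer_instance

theorem measurable_diagGaussian {S : Type*} [MeasurableSpace S] {d : ℕ} {m : S → Image d}
    {v : S → Fin d → ℝ≥0} (hm : Measurable m) (hv : Measurable v) :
    Measurable fun p => diagGaussian (m p) (v p) := by
  refine Measurable.measure_of_isPiSystem_of_isProbabilityMeasure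
    generateFrom_pi.symm isPiSystem_pi ?_
  rintro _ ⟨s, hs, rfl⟩
  simp only [diagGaussian, Measure.pi_pi]
  refine Finset.measurable_prod _ fun j _ => ?_
  have h : Measurable fun p => gaussianReal (m p j) (v p j) :=
    measurable_gaussianReal.comp
      (((measurable_pi_apply j).comp hm).prodMk ((measurable_pi_apply j).comp hv))
  have hj : MeasurableSet (s j) := hs j (Set.mem_univ j)
  exact (Measure.measurable_coe hj).comp h

/-! ### The diffusion model -/

/-- A denoising diffusion model with `T` steps on images with `d` pixels: a noise schedule
`β₁, …, β_T ∈ (0, 1)`, a noise predictor `ε_θ(x, t)` and a diagonal covariance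
`Σ_θ(x, t) = diag (variance t x)` with positive entries. -/
structure DiffusionModel (d : ℕ) where
  /-- The number of steps. -/
  T : ℕ
  /-- The variance schedule `β_t`; only `1 ≤ t ≤ T` matters. -/
  β : ℕ → ℝ
  β_mem : ∀ t ∈ Finset.Icc 1 T, β t ∈ Set.Ioo (0 : ℝ) 1
  /-- `eps t x = ε_θ(x, t)`. -/
  eps : ℕ → Image d → Image d
  measurable_eps : ∀ t, Measurable (eps t)
  /-- `variance t x j` is the `j`-th diagonal entry `σ²_{t,j}` of `Σ_θ(x, t)`. -/
  variance : ℕ → Image d → Fin d → ℝ≥0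
  measurable_variance : ∀ t, Measurable (variance t)
  variance_pos : ∀ t ∈ Finset.Icc 1 T, ∀ x j, 0 < variance t x j

namespace DiffusionModel

variable {d : ℕ} (D : DiffusionModel d)

/-- `α_t = 1 - β_t`. -/
def alpha (t : ℕ) : ℝ := 1 - D.β t

/-- `ᾱ_t = α_1 ⋯ α_t`, with `ᾱ_0 = 1`. -/
def alphaBar (t : ℕ) : ℝ := ∏ u ∈ Finset.Icc 1 t, D.alpha u

/-- The prediction `x̂₀ᵗ = (x_t - √(1 - ᾱ_t) ε_θ(x_t, t)) / √ᾱ_t` of the clean image. -/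
def predict (t : ℕ) (xt : Image d) : Image d := fun j =>
  1 / √(D.alphaBar t) * (xt j - √(1 - D.alphaBar t) * D.eps t xt j)

/-- The privacy filter at one pixel, for budget `Λ`, guidance scale `s`, time `t` and noise
variance `v = σ_t²` at that pixel. It returns the new budget and whether guidance is allowed. -/
def privacyFilter (s : ℝ) (t : ℕ) (v : ℝ) (Λ : ℝ) : ℝ × Bool :=
  let Λ' := Λ - s ^ 2 *
    (D.alphaBar (t - 1) * (1 - D.alpha t) ^ 2 / ((1 - D.alphaBar t) ^ 2 * v))
  if Λ' ≤ 0 then (Λ, false) else (Λ', true)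

/-- The privacy filter applied at every pixel, with the noise variances predicted from `x_t`. -/
def imageFilter (s : ℝ) (t : ℕ) (xt : Image d) (Λ : Fin d → ℝ) (j : Fin d) : ℝ × Bool :=
  D.privacyFilter s t (D.variance t xt j) (Λ j)

/-- The prediction `x̂₀ᵗ` after guidance: it is moved towards the original image `x` with scale
`s` at the pixels where the filter allows it. -/
def guided (x : Image d) (s : ℝ) (t : ℕ) (xt : Image d) (Λ : Fin d → ℝ) : Image d := fun j =>
  if (D.imageFilter s t xt Λ j).2 = true then
    D.predict t xt j + s * (x j - D.predict t xt j)
  else D.predict t xt j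

/-- The mean of `x_{t-1}`, given `x_t` and the budgets before step `t`. -/
def stepMean (x : Image d) (s : ℝ) (t : ℕ) (xt : Image d) (Λ : Fin d → ℝ) : Image d := fun j =>
  √(D.alphaBar (t - 1)) * (1 - D.alpha t) / (1 - D.alphaBar t) * D.guided x s t xt Λ j
    + (1 - D.alphaBar (t - 1)) * √(D.alpha t) / (1 - D.alphaBar t) * xt j

theorem measurable_variance_apply (t : ℕ) (j : Fin d) :
    Measurable fun p : Image d × (Fin d → ℝ) => (D.variance t p.1 j : ℝ) :=
  measurable_coe_nnreal_real.comp
    ((measurable_pi_apply j).comp ((D.measurable_variance t).comp measurable_fst))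

theorem measurable_imageFilter (s : ℝ) (t : ℕ) (j : Fin d) :
    Measurable fun p : Image d × (Fin d → ℝ) => D.imageFilter s t p.1 p.2 j := by
  have hv := D.measurable_variance_apply t j
  have hΛ : Measurable fun p : Image d × (Fin d → ℝ) => p.2 j :=
    (measurable_pi_apply j).comp measurable_snd
  have h' : Measurable fun p : Image d × (Fin d → ℝ) => p.2 j - s ^ 2 *
      (D.alphaBar (t - 1) * (1 - D.alpha t) ^ 2 /
        ((1 - D.alphaBar t) ^ 2 * (D.variance t p.1 j : ℝ))) :=
    hΛ.sub (((hv.const_mul _).const_div _).const_mul _)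
  exact Measurable.ite (measurableSet_le h' measurable_const)
    (hΛ.prodMk measurable_const) (h'.prodMk measurable_const)

theorem measurable_predict (t : ℕ) : Measurable (D.predict t) := by
  refine measurable_pi_lambda _ fun j => ?_
  exact ((measurable_pi_apply j).sub
    (((measurable_pi_apply j).comp (D.measurable_eps t)).const_mul _)).const_mul _

theorem measurable_stepMean (x : Image d) (s : ℝ) (t : ℕ) :
    Measurable fun p : Image d × (Fin d → ℝ) => D.stepMean x s t p.1 p.2 := by
  refine measurable_pi_lambda _ fun j => ?_
  have hp : Measurable fun p : Image d × (Fin d → ℝ) => D.predict t p.1 j :=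
    (measurable_pi_apply j).comp ((D.measurable_predict t).comp measurable_fst)
  have hg : Measurable fun p : Image d × (Fin d → ℝ) => D.guided x s t p.1 p.2 j :=
    Measurable.ite
      (measurable_snd.comp (D.measurable_imageFilter s t j) (measurableSet_singleton true))
      (hp.add ((hp.const_sub _).const_mul _)) hp
  exact (hg.const_mul _).add
    (((measurable_pi_apply j).comp measurable_fst).const_mul _)

/-- Step `t` of guided denoising of the original image `x`, as a Markov kernel on pairs
`(x_t, Λ)`: draw `x_{t-1} ∼ N(mean, Σ_θ(x_t, t))` and update the budgets by the filter. -/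
def step (x : Image d) (s : ℝ) (t : ℕ) :
    Kernel (Image d × (Fin d → ℝ)) (Image d × (Fin d → ℝ)) :=
  Kernel.prod
    { toFun := fun p => diagGaussian (D.stepMean x s t p.1 p.2) (D.variance t p.1)
      measurable' := measurable_diagGaussian (D.measurable_stepMean x s t)
        ((D.measurable_variance t).comp measurable_fst) }
    (Kernel.deterministic (fun p j => (D.imageFilter s t p.1 p.2 j).1)
      (measurable_pi_lambda _ fun j => measurable_fst.comp (D.measurable_imageFilter s t j)))

instance step_isMarkovKernel (x : Image d) (s : ℝ) (t : ℕ) : IsMarkovKernel (D.step x s t) := by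
  unfold step
  refine @Kernel.IsMarkovKernel.prod _ _ _ _ _ _ _ ⟨fun p => ?_⟩ _ inferInstance
  exact diagGaussian_isProbabilityMeasure _ _

/-- The steps `t, t - 1, …, 1`, in this order. -/
def run (x : Image d) (s : ℝ) : (t : ℕ) →
    Kernel (Image d × (Fin d → ℝ)) (Image d × (Fin d → ℝ))
  | 0 => Kernel.id
  | t + 1 => (run x s t).comp (D.step x s (t + 1))

instance run_isMarkovKernel (x : Image d) (s : ℝ) (t : ℕ) : IsMarkovKernel (D.run x s t) := by
  induction t with
  | zero => unfold run; infer_instance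
  | succ t ih => unfold run; infer_instance

/-- The law of the initial pair `(x_T, Λ)`: `x_T ∼ N(0, I)`, and every pixel has the budget
`μ² = 1 / σ²`. -/
def init (d : ℕ) (σ : ℝ) : Measure (Image d × (Fin d → ℝ)) :=
  (diagGaussian 0 1).prod (Measure.dirac fun _ => (1 / σ) ^ 2)

instance init_isProbabilityMeasure (d : ℕ) (σ : ℝ) : IsProbabilityMeasure (init d σ) := by
  unfold init; infer_instance

/-- Clean image guided denoising: the law of the output `x₀` for the original image `x`, the
guidance scale `s` and the total variance `σ²`. -/
def guidedDenoising (s σ : ℝ) (x : Image d) : ProbabilityMeasure (Image d) :=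
  ⟨((init d σ).bind (D.run x s D.T)).map Prod.fst,
    Measure.isProbabilityMeasure_map measurable_fst.aemeasurable⟩

end DiffusionModel

end

/-!
Differential privacy of the filtered algorithm is proved through hockey-stick divergences instead
of trade-off functions. For a Gaussian shift of squared length `v`, the divergence
`sup_φ (w E_Q φ - l E_P φ)` over tests `φ` is `hockeyStick w l v`, the expectation of
`(w exp (z - v / 2) - l)⁺` for `z ∼ N(0, v)`. These expectations compose: weighting by the
likelihood ratio of an independent shift of squared length `κ` and averaging replaces `v` by
`κ + v`, since variances of independent normal variables add (`integral_hockeyStick`).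

For two original images that differ only at pixel `i`, the means of a denoising step differ only
at pixel `i`, and the squared shift in units of the noise is exactly the budget spent by the filter
times the squared difference of the images (`DiffusionModel.stepMean_sub_sq_div`). The new budget
is a function of the state before the step, so backward induction over the steps, keeping the
budget in the state, bounds the divergence of the outputs by that of a Gaussian shift whose squared
length is the budget times the squared difference (`diagGaussian_sub_le_hockeyStick`,
`DiffusionModel.rejection_sub_le_hockeyStick`). The filter never lets the budget become negative,
and an unspent budget is harmless by Jensen's inequality (`sub_le_hockeyStick`).

Finally, a bound on all hockey-stick divergences gives back the bound on the trade-off function: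
by the Neyman–Pearson argument, the test that rejects above a threshold `c` attains the divergence
whose `l` is the likelihood ratio at `c`, and thresholds realize every level in `(0, 1)`
(`thresholdPower_sub_eq_hockeyStick`, `gaussianTradeoff_le_tradeoff`).
-/

/-! ### Integrals of tests -/

theorem integrable_of_measurable_of_mem_Icc {Y : Type*} [MeasurableSpace Y] {μ : Measure Y}
    [IsFiniteMeasure μ] {f : Y → ℝ} (hf : Measurable f) (hf1 : ∀ y, f y ∈ Set.Icc (0 : ℝ) 1) :
    Integrable f μ :=
  Integrable.of_bound hf.aestronglyMeasurable 1 (.of_forall fun y => by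
    rw [Real.norm_eq_abs, abs_of_nonneg (hf1 y).1]; exact (hf1 y).2)

theorem integral_mem_Icc {Y : Type*} [MeasurableSpace Y] {μ : Measure Y}
    [IsProbabilityMeasure μ] {f : Y → ℝ} (hf : Measurable f)
    (hf1 : ∀ y, f y ∈ Set.Icc (0 : ℝ) 1) : ∫ y, f y ∂μ ∈ Set.Icc (0 : ℝ) 1 := by
  refine ⟨integral_nonneg fun y => (hf1 y).1, ?_⟩
  have := integral_mono (integrable_of_measurable_of_mem_Icc hf hf1) (integrable_const (1 : ℝ))
    (μ := μ) fun y => (hf1 y).2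
  simpa using this

/-! ### The hockey-stick divergence of Gaussian shifts -/

/-- The hockey-stick divergence `∫ (w q - l p)⁺` of the unit normal densities `q`, `p` whose means
are at distance `√v`. Under `p`, the log-likelihood ratio is `z - v / 2` with `z ∼ N(0, v)`, and
the divergence is written as an expectation over `z`. -/
noncomputable def hockeyStick (w l : ℝ) (v : ℝ≥0) : ℝ :=
  ∫ z, max (w * Real.exp (z - v / 2) - l) 0 ∂gaussianReal 0 v

theorem integrable_exp_sub_half (v : ℝ≥0) :
    Integrable (fun z => Real.exp (z - v / 2)) (gaussianReal 0 v) := by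
  have h := (integrable_exp_mul_gaussianReal (μ := 0) (v := v) 1).mul_const (Real.exp (-(v / 2)))
  refine h.congr (.of_forall fun z => ?_)
  simp only [one_mul, ← Real.exp_add, sub_eq_add_neg]

theorem integral_exp_sub_half (v : ℝ≥0) :
    ∫ z, Real.exp (z - v / 2) ∂gaussianReal 0 v = 1 := by
  have h : ∫ z, Real.exp (1 * z) ∂gaussianReal 0 v = Real.exp (v / 2) := by
    have := congrFun (mgf_id_gaussianReal (μ := 0) (v := v)) 1
    simpa [mgf] using this
  calc ∫ z, Real.exp (z - v / 2) ∂gaussianReal 0 v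
      = ∫ z, Real.exp (1 * z) * Real.exp (-(v / 2)) ∂gaussianReal 0 v := by
        simp only [one_mul, ← Real.exp_add, sub_eq_add_neg]
    _ = 1 := by rw [integral_mul_const, h, ← Real.exp_add, add_neg_cancel, Real.exp_zero]

theorem integrable_hockeyStick (w l : ℝ) (v : ℝ≥0) :
    Integrable (fun z => max (w * Real.exp (z - v / 2) - l) 0) (gaussianReal 0 v) :=
  (((integrable_exp_sub_half v).const_mul w).sub (integrable_const l)).pos_part

theorem hockeyStick_nonneg (w l : ℝ) (v : ℝ≥0) : 0 ≤ hockeyStick w l v :=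
  integral_nonneg fun _ => le_max_right _ _

/-- Jensen's inequality: together with `hockeyStick_nonneg`, the divergence at any `v` is at least
its value `(w - l)⁺` at `v = 0`. -/
theorem sub_le_hockeyStick (w l : ℝ) (v : ℝ≥0) : w - l ≤ hockeyStick w l v := by
  have h : ∫ z, (w * Real.exp (z - v / 2) - l) ∂gaussianReal 0 v = w - l := by
    rw [integral_sub ((integrable_exp_sub_half v).const_mul w) (integrable_const l),
      integral_const_mul, integral_exp_sub_half]
    simp
  rw [← h]
  exact integral_mono (((integrable_exp_sub_half v).const_mul w).sub (integrable_const l))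
    (integrable_hockeyStick w l v) fun z => le_max_left _ _

theorem integrable_hockeyStick_prod (w l : ℝ) (κ v : ℝ≥0) :
    Integrable (fun p : ℝ × ℝ =>
      max (w * Real.exp (p.1 - κ / 2) * Real.exp (p.2 - v / 2) - l) 0)
      ((gaussianReal 0 κ).prod (gaussianReal 0 v)) := by
  have h := ((integrable_exp_sub_half κ).mul_prod (integrable_exp_sub_half v)).const_mul w
  refine ((h.sub (integrable_const l)).pos_part).congr (.of_forall fun p => ?_)
  simp only [mul_assoc, Pi.sub_apply]

/-- Composition: divergences of independent Gaussian shifts compose by adding the squared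
distances `κ` and `v`. -/
theorem integral_hockeyStick (w l : ℝ) (κ v : ℝ≥0) :
    ∫ u, hockeyStick (w * Real.exp (u - κ / 2)) l v ∂gaussianReal 0 κ
      = hockeyStick w l (κ + v) := by
  -- `N(0, κ + v)` is the law of the sum of independent `N(0, κ)` and `N(0, v)` variables.
  have hconv : (gaussianReal 0 (κ + v)) =
      ((gaussianReal 0 κ).prod (gaussianReal 0 v)).map (fun p : ℝ × ℝ => p.1 + p.2) := by
    rw [← Measure.conv, gaussianReal_conv_gaussianReal, add_zero]
  unfold hockeyStick
  rw [hconv, integral_map (by fun_prop) (by fun_prop),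
    ← integral_prod _ (integrable_hockeyStick_prod w l κ v)]
  congr 1 with p
  rw [mul_assoc, ← Real.exp_add]
  have h : p.1 - κ / 2 + (p.2 - v / 2) = p.1 + p.2 - ((κ + v : ℝ≥0) : ℝ) / 2 := by
    push_cast
    ring
  rw [h]

theorem integrable_hockeyStick_comp (w l : ℝ) (κ v : ℝ≥0) :
    Integrable (fun u => hockeyStick (w * Real.exp (u - κ / 2)) l v) (gaussianReal 0 κ) :=
  (integrable_hockeyStick_prod w l κ v).integral_prod_left

/-! ### Gaussian shifts -/

/-- The likelihood ratio of two normal laws with the same variance. -/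
theorem gaussianReal_eq_withDensity (m m' : ℝ) {v : ℝ≥0} (hv : v ≠ 0) :
    gaussianReal m' v = (gaussianReal m v).withDensity fun y =>
      ENNReal.ofReal (Real.exp ((m' - m) / v * (y - m) - (m' - m) ^ 2 / v / 2)) := by
  rw [gaussianReal_of_var_ne_zero _ hv, gaussianReal_of_var_ne_zero _ hv,
    ← withDensity_mul _ (measurable_gaussianPDF _ _) (by fun_prop)]
  congr 1 with y
  have hv' : (v : ℝ) ≠ 0 := by exact_mod_cast hv
  rw [Pi.mul_apply, gaussianPDF, gaussianPDF, ← ENNReal.ofReal_mul (gaussianPDFReal_nonneg _ _ _)]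
  congr 1
  rw [gaussianPDFReal, gaussianPDFReal, mul_assoc _ (Real.exp _), ← Real.exp_add]
  congr 2
  field_simp
  ring

theorem pi_withDensity_ofReal {ι : Type*} [Fintype ι] {E : ι → Type*}
    [∀ j, MeasurableSpace (E j)] (P : ∀ j, Measure (E j)) [∀ j, IsFiniteMeasure (P j)]
    (f : ∀ j, E j → ℝ) (hf : ∀ j, Integrable (f j) (P j)) (hf0 : ∀ j y, 0 ≤ f j y) :
    (Measure.pi P).withDensity (fun y => ENNReal.ofReal (∏ j, f j (y j))) =
      Measure.pi fun j => (P j).withDensity fun y => ENNReal.ofReal (f j y) := by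
  have : ∀ j, IsFiniteMeasure ((P j).withDensity fun y => ENNReal.ofReal (f j y)) := fun j =>
    isFiniteMeasure_withDensity_ofReal (hf j).2
  refine (Measure.pi_eq fun s hs => ?_).symm
  rw [withDensity_apply _ (MeasurableSet.univ_pi hs), Measure.restrict_pi_pi,
    ← ofReal_integral_eq_lintegral_ofReal
      (Integrable.fintype_prod_dep fun j => (hf j).restrict)
      (.of_forall fun y => Finset.prod_nonneg fun j _ => hf0 j _),
    integral_fintype_prod_eq_prod,
    ENNReal.ofReal_prod_of_nonneg fun j _ => integral_nonneg (hf0 j)]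
  refine Finset.prod_congr rfl fun j _ => ?_
  rw [withDensity_apply _ (hs j),
    ofReal_integral_eq_lintegral_ofReal (hf j).restrict (.of_forall (hf0 j))]

theorem integrable_exp_affine_gaussianReal (a b c m : ℝ) (v : ℝ≥0) :
    Integrable (fun y => Real.exp (a * (y - b) - c)) (gaussianReal m v) := by
  refine ((integrable_exp_mul_gaussianReal (μ := m) (v := v) a).mul_const
    (Real.exp (-(a * b) - c))).congr (.of_forall fun y => ?_)
  simp only [← Real.exp_add]
  congr 1
  ring

/-- The likelihood ratio of two diagonal normal laws whose means differ only at pixel `i`. -/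
theorem diagGaussian_eq_withDensity {d : ℕ} (i : Fin d) {m m' : Image d} {v : Fin d → ℝ≥0}
    (hv : ∀ j, v j ≠ 0) (hm : ∀ j, j ≠ i → m' j = m j) :
    diagGaussian m' v = (diagGaussian m v).withDensity fun y =>
      ENNReal.ofReal (Real.exp ((m' i - m i) / v i * (y i - m i) - (m' i - m i) ^ 2 / v i / 2)) := by
  have h := pi_withDensity_ofReal (fun j => gaussianReal (m j) (v j))
    (fun j y => Real.exp ((m' j - m j) / v j * (y - m j) - (m' j - m j) ^ 2 / v j / 2))
    (fun j => integrable_exp_affine_gaussianReal _ _ _ _ _) fun j y => (Real.exp_pos _).le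
  have hQ : (fun j => (gaussianReal (m j) (v j)).withDensity fun y => ENNReal.ofReal
      (Real.exp ((m' j - m j) / v j * (y - m j) - (m' j - m j) ^ 2 / v j / 2))) =
      fun j => gaussianReal (m' j) (v j) :=
    funext fun j => (gaussianReal_eq_withDensity (m j) (m' j) (hv j)).symm
  rw [hQ] at h
  unfold diagGaussian
  rw [← h]
  congr 1 with y
  rw [Finset.prod_eq_single i (fun j _ hj => by simp [hm j hj]) (by simp)]

/-- One noisy step. If, for every outcome `y`, the future tests `a y` and `b y` are as hard to
distinguish as a Gaussian shift of squared length `v'`, then drawing `y` from normal laws shifted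
by `δ = m' i - m i` adds `κ = δ ^ 2 / v i` to the squared length. -/
theorem diagGaussian_sub_le_hockeyStick {d : ℕ} (i : Fin d) {m m' : Image d} {v : Fin d → ℝ≥0}
    (hv : ∀ j, v j ≠ 0) (hm : ∀ j, j ≠ i → m' j = m j) {κ v' : ℝ≥0}
    (hκ : (κ : ℝ) = (m' i - m i) ^ 2 / v i) {a b : Image d → ℝ}
    (ha : Measurable a) (ha1 : ∀ y, a y ∈ Set.Icc (0 : ℝ) 1)
    (hb : Measurable b) (hb1 : ∀ y, b y ∈ Set.Icc (0 : ℝ) 1) (w l : ℝ)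
    (hab : ∀ y u, w * Real.exp u * b y - l * a y ≤ hockeyStick (w * Real.exp u) l v') :
    w * ∫ y, b y ∂diagGaussian m' v - l * ∫ y, a y ∂diagGaussian m v
      ≤ hockeyStick w l (κ + v') := by
  set g : Image d → ℝ := fun y => (m' i - m i) / v i * (y i - m i) with hg
  -- The log-likelihood ratio of the step is `g - κ / 2`, and `g` has the law `N(0, κ)`.
  have hmap : (diagGaussian m v).map g = gaussianReal 0 κ := by
    have h1 : (diagGaussian m v).map (fun y => y i) = gaussianReal (m i) (v i) :=
      (measurePreserving_eval (fun j => gaussianReal (m j) (v j)) i).map_eq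
    have h2 : g = (fun z => (m' i - m i) / v i * z) ∘ (fun z => z - m i) ∘ fun y => y i := rfl
    rw [h2, ← Measure.map_map (by fun_prop) (by fun_prop),
      ← Measure.map_map (by fun_prop) (by fun_prop), h1, gaussianReal_map_sub_const,
      gaussianReal_map_const_mul]
    have hv' : (v i : ℝ) ≠ 0 := by exact_mod_cast hv i
    congr 1
    · simp
    · apply NNReal.coe_injective
      push_cast
      rw [hκ]
      field_simp
  have hgm : Measurable g := by fun_prop
  have hB : ∫ y, b y ∂diagGaussian m' v =
      ∫ y, Real.exp (g y - κ / 2) * b y ∂diagGaussian m v := by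
    rw [diagGaussian_eq_withDensity i hv hm, integral_withDensity_eq_integral_toReal_smul
      (by fun_prop) (.of_forall fun _ => ENNReal.ofReal_lt_top)]
    congr 1 with y
    rw [ENNReal.toReal_ofReal (Real.exp_pos _).le, smul_eq_mul, hκ]
  have hexp : Integrable (fun y => Real.exp (g y - κ / 2)) (diagGaussian m v) := by
    have h := integrable_exp_sub_half κ
    rw [← hmap] at h
    exact h.comp_measurable hgm
  have hIb : Integrable (fun y => Real.exp (g y - κ / 2) * b y) (diagGaussian m v) :=
    hexp.mul_bdd (c := 1) hb.aestronglyMeasurable (.of_forall fun y => by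
      rw [Real.norm_eq_abs, abs_of_nonneg (hb1 y).1]; exact (hb1 y).2)
  have hIa : Integrable a (diagGaussian m v) :=
    integrable_of_measurable_of_mem_Icc ha ha1
  have hH := integrable_hockeyStick_comp w l κ v'
  have hHs := hH.aestronglyMeasurable
  rw [← hmap] at hH hHs
  rw [hB, ← integral_hockeyStick, ← hmap, integral_map hgm.aemeasurable hHs,
    ← integral_const_mul, ← integral_const_mul, ← integral_sub (hIb.const_mul w) (hIa.const_mul l)]
  refine integral_mono ((hIb.const_mul w).sub (hIa.const_mul l)) (hH.comp_measurable hgm)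
    fun y => ?_
  have := hab y (g y - κ / 2)
  simp only [← mul_assoc]
  exact this

/-! ### The privacy filter -/

namespace DiffusionModel

variable {d : ℕ} (D : DiffusionModel d)

theorem alpha_mem_Ioo {t : ℕ} (ht : t ∈ Finset.Icc 1 D.T) : D.alpha t ∈ Set.Ioo (0 : ℝ) 1 := by
  have := D.β_mem t ht
  exact ⟨by unfold alpha; linarith [this.2], by unfold alpha; linarith [this.1]⟩

theorem alphaBar_pos {t : ℕ} (ht : t ≤ D.T) : 0 < D.alphaBar t :=
  Finset.prod_pos fun _ hu => (D.alpha_mem_Ioo (Finset.Icc_subset_Icc_right ht hu)).1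

theorem imageFilter_fst_nonneg (s : ℝ) (t : ℕ) (xt : Image d) {Λ : Fin d → ℝ} {j : Fin d}
    (hΛ : 0 ≤ Λ j) : 0 ≤ (D.imageFilter s t xt Λ j).1 := by
  unfold imageFilter privacyFilter
  dsimp only
  split_ifs with h
  · exact hΛ
  · exact (not_le.1 h).le

theorem stepMean_eq_of_eq {x x' : Image d} (s : ℝ) (t : ℕ) (xt : Image d) (Λ : Fin d → ℝ)
    {j : Fin d} (h : x' j = x j) : D.stepMean x' s t xt Λ j = D.stepMean x s t xt Λ j := by
  simp only [stepMean, guided, h]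

/-- The filter charges pixel `j` the squared shift of the mean, measured in units of the
noise and of the difference of the original images. -/
theorem stepMean_sub_sq_div (x x' : Image d) (s : ℝ) {t : ℕ} (ht : t ≤ D.T)
    (xt : Image d) (Λ : Fin d → ℝ) (j : Fin d) :
    (D.stepMean x' s t xt Λ j - D.stepMean x s t xt Λ j) ^ 2 / D.variance t xt j
      = (x' j - x j) ^ 2 * (Λ j - (D.imageFilter s t xt Λ j).1) := by
  have hA : √(D.alphaBar (t - 1)) ^ 2 = D.alphaBar (t - 1) :=
    Real.sq_sqrt (D.alphaBar_pos ((Nat.sub_le _ _).trans ht)).le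
  unfold stepMean guided imageFilter privacyFilter
  dsimp only
  by_cases h : Λ j - s ^ 2 * (D.alphaBar (t - 1) * (1 - D.alpha t) ^ 2 /
      ((1 - D.alphaBar t) ^ 2 * D.variance t xt j)) ≤ 0
  · simp only [if_pos h]
    simp
  · simp only [if_neg h, if_true]
    rw [sub_sub_cancel]
    generalize √(D.alphaBar (t - 1)) = A at hA ⊢
    generalize 1 - D.alphaBar t = B
    rw [← hA]
    ring

/-- The conditional probability that a test `φ` of the output rejects, given the state before
step `t`. -/
noncomputable def rejection (x : Image d) (s : ℝ) (φ : Image d → ℝ) (t : ℕ)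
    (p : Image d × (Fin d → ℝ)) : ℝ :=
  ∫ q, φ q.1 ∂D.run x s t p

variable {φ : Image d → ℝ}

theorem measurable_rejection (x : Image d) (s : ℝ) (hφ : Measurable φ) (t : ℕ) :
    Measurable (D.rejection x s φ t) :=
  ((hφ.comp measurable_fst).stronglyMeasurable.integral_kernel).measurable

theorem rejection_mem_Icc (x : Image d) (s : ℝ) (hφ : Measurable φ)
    (hφ1 : ∀ y, φ y ∈ Set.Icc (0 : ℝ) 1) (t : ℕ) (p : Image d × (Fin d → ℝ)) :
    D.rejection x s φ t p ∈ Set.Icc (0 : ℝ) 1 :=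
  integral_mem_Icc (hφ.comp measurable_fst) fun q => hφ1 q.1

theorem rejection_zero (x : Image d) (s : ℝ) (hφ : Measurable φ)
    (p : Image d × (Fin d → ℝ)) : D.rejection x s φ 0 p = φ p.1 := by
  unfold rejection run
  rw [Kernel.id_apply]
  exact integral_dirac' _ _ (hφ.comp measurable_fst).stronglyMeasurable

theorem rejection_succ (x : Image d) (s : ℝ) (hφ : Measurable φ)
    (hφ1 : ∀ y, φ y ∈ Set.Icc (0 : ℝ) 1) (t : ℕ) (p : Image d × (Fin d → ℝ)) :
    D.rejection x s φ (t + 1) p =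
      ∫ y, D.rejection x s φ t (y, fun j => (D.imageFilter s (t + 1) p.1 p.2 j).1)
        ∂diagGaussian (D.stepMean x s (t + 1) p.1 p.2) (D.variance (t + 1) p.1) := by
  have hm := hφ.comp (measurable_fst : Measurable (Prod.fst : Image d × (Fin d → ℝ) → Image d))
  have hint : ∀ (μ : Measure (Image d × (Fin d → ℝ))) [IsProbabilityMeasure μ],
      Integrable (fun q => φ q.1) μ := fun μ _ =>
    integrable_of_measurable_of_mem_Icc hm fun q => hφ1 q.1
  have h1 : D.rejection x s φ (t + 1) p =
      ∫ q, D.rejection x s φ t q ∂D.step x s (t + 1) p := by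
    have : IsProbabilityMeasure (((D.run x s t).comp (D.step x s (t + 1))) p) := inferInstance
    exact Kernel.integral_comp (hint _)
  have hR : ∀ q, D.rejection x s φ t q ∈ Set.Icc (0 : ℝ) 1 := D.rejection_mem_Icc x s hφ hφ1 t
  have hRm := D.measurable_rejection x s hφ t
  have hstep : D.step x s (t + 1) p =
      (diagGaussian (D.stepMean x s (t + 1) p.1 p.2) (D.variance (t + 1) p.1)).prod
        (Measure.dirac fun j => (D.imageFilter s (t + 1) p.1 p.2 j).1) := by
    unfold step
    have : IsMarkovKernel (⟨fun p => diagGaussian (D.stepMean x s (t + 1) p.1 p.2)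
        (D.variance (t + 1) p.1), measurable_diagGaussian (D.measurable_stepMean x s (t + 1))
        ((D.measurable_variance (t + 1)).comp measurable_fst)⟩ :
        Kernel (Image d × (Fin d → ℝ)) (Image d)) :=
      ⟨fun _ => diagGaussian_isProbabilityMeasure _ _⟩
    rw [Kernel.prod_apply, Kernel.deterministic_apply]
    rfl
  rw [h1, hstep, integral_prod _ (integrable_of_measurable_of_mem_Icc hRm hR)]
  congr 1 with y
  exact integral_dirac' _ _ (hRm.comp measurable_prodMk_left).stronglyMeasurable

/-- From a state with budget `Λ`, the outputs on two original images that differ only at pixel `i`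
are as hard to distinguish as a Gaussian shift whose squared length `v` bounds the remaining budget,
in units of the squared difference of the images. The budget after a step depends only on the
state before it, so each step is an instance of `diagGaussian_sub_le_hockeyStick`. -/
theorem rejection_sub_le_hockeyStick {x x' : Image d} (s : ℝ) {i : Fin d}
    (hx : ∀ j, j ≠ i → x' j = x j) (hφ : Measurable φ) (hφ1 : ∀ y, φ y ∈ Set.Icc (0 : ℝ) 1)
    {l : ℝ} {t : ℕ} (ht : t ≤ D.T) {w : ℝ} {v : ℝ≥0}
    {p : Image d × (Fin d → ℝ)} (hΛ : 0 ≤ p.2 i) (hv : (x' i - x i) ^ 2 * p.2 i ≤ v) :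
    w * D.rejection x' s φ t p - l * D.rejection x s φ t p ≤ hockeyStick w l v := by
  induction t generalizing w v p with
  | zero =>
    rw [D.rejection_zero _ _ hφ, D.rejection_zero _ _ hφ, ← sub_mul]
    -- `(w - l) * φ ≤ (w - l)⁺` because `0 ≤ φ ≤ 1`.
    have h1 := hφ1 p.1
    have h2 := sub_le_hockeyStick w l v
    have h3 := hockeyStick_nonneg w l v
    nlinarith [mul_nonneg h1.1 (sub_nonneg.2 h2), mul_nonneg (sub_nonneg.2 h1.2) h3]
  | succ t ih =>
    set Λ' : Fin d → ℝ := fun j => (D.imageFilter s (t + 1) p.1 p.2 j).1 with hΛ'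
    have hΛ'0 : 0 ≤ Λ' i := D.imageFilter_fst_nonneg s (t + 1) p.1 hΛ
    have hκ := D.stepMean_sub_sq_div x x' s ht p.1 p.2 i
    set κ : ℝ := (D.stepMean x' s (t + 1) p.1 p.2 i - D.stepMean x s (t + 1) p.1 p.2 i) ^ 2 /
      D.variance (t + 1) p.1 i with hκdef
    have hκ0 : 0 ≤ κ := by positivity
    change κ = (x' i - x i) ^ 2 * (p.2 i - Λ' i) at hκ
    -- The squared length left for the remaining steps.
    have hv' : (x' i - x i) ^ 2 * Λ' i ≤ v - κ := by rw [hκ]; linarith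
    have hv'0 : 0 ≤ v - κ := (mul_nonneg (sq_nonneg _) hΛ'0).trans hv'
    have hsum : v = (⟨κ, hκ0⟩ : ℝ≥0) + (⟨v - κ, hv'0⟩ : ℝ≥0) := by
      apply NNReal.coe_injective
      change (v : ℝ) = κ + (v - κ)
      ring
    have hmk : Measurable fun y : Image d => (y, Λ') := measurable_prodMk_right
    rw [D.rejection_succ x' s hφ hφ1, D.rejection_succ x s hφ hφ1, hsum]
    exact diagGaussian_sub_le_hockeyStick i
      (fun j => (D.variance_pos (t + 1) (Finset.mem_Icc.2 ⟨Nat.le_add_left 1 t, ht⟩) p.1 j).ne')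
      (fun j hj => D.stepMean_eq_of_eq s (t + 1) p.1 p.2 (hx j hj)) rfl
      ((D.measurable_rejection x s hφ t).comp hmk)
      (fun y => D.rejection_mem_Icc x s hφ hφ1 t _)
      ((D.measurable_rejection x' s hφ t).comp hmk)
      (fun y => D.rejection_mem_Icc x' s hφ hφ1 t _) w l
      fun y u => ih (Nat.le_of_succ_le ht) (p := (y, Λ')) hΛ'0 hv'

theorem integral_guidedDenoising (x : Image d) (s σ : ℝ) (hφ : Measurable φ)
    (hφ1 : ∀ y, φ y ∈ Set.Icc (0 : ℝ) 1) :
    ∫ y, φ y ∂(D.guidedDenoising s σ x : Measure (Image d)) =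
      ∫ y, D.rejection x s φ D.T (y, fun _ => (1 / σ) ^ 2) ∂diagGaussian 0 1 := by
  have hm := hφ.comp (measurable_fst : Measurable (Prod.fst : Image d × (Fin d → ℝ) → Image d))
  have hRm := D.measurable_rejection x s hφ D.T
  change ∫ y, φ y ∂((init d σ).bind (D.run x s D.T)).map Prod.fst = _
  have : IsProbabilityMeasure (((D.run x s D.T).comp (Kernel.const Unit (init d σ))) ()) :=
    inferInstance
  rw [integral_map measurable_fst.aemeasurable hφ.aestronglyMeasurable,
    Measure.comp_eq_comp_const_apply, Kernel.integral_comp (f := fun q : Image d × (Fin d → ℝ) => φ q.1)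
      (integrable_of_measurable_of_mem_Icc hm fun q => hφ1 q.1), Kernel.const_apply]
  change ∫ p, D.rejection x s φ D.T p ∂init d σ = _
  unfold init
  rw [integral_prod _ (integrable_of_measurable_of_mem_Icc hRm
    (D.rejection_mem_Icc x s hφ hφ1 D.T))]
  congr 1 with y
  exact integral_dirac' _ _ (hRm.comp measurable_prodMk_left).stronglyMeasurable

/-- The hockey-stick divergences of the outputs on neighbouring images are at most those of a
Gaussian shift by `r / σ`. -/
theorem guidedDenoising_sub_le_hockeyStick {x x' : Image d} (s σ : ℝ) {i : Fin d} {r : ℝ}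
    (hx : PixelNeighbours i r x x') (hφ : Measurable φ) (hφ1 : ∀ y, φ y ∈ Set.Icc (0 : ℝ) 1)
    (l : ℝ) {v : ℝ≥0} (hv : (v : ℝ) = (r / σ) ^ 2) :
    ∫ y, φ y ∂(D.guidedDenoising s σ x' : Measure (Image d))
      - l * ∫ y, φ y ∂(D.guidedDenoising s σ x : Measure (Image d)) ≤ hockeyStick 1 l v := by
  have hmk : Measurable fun y : Image d => (y, fun _ : Fin d => (1 / σ) ^ 2) :=
    measurable_prodMk_right
  have hI : ∀ x, Integrable (fun y => D.rejection x s φ D.T (y, fun _ => (1 / σ) ^ 2))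
      (diagGaussian 0 1) := fun x =>
    integrable_of_measurable_of_mem_Icc ((D.measurable_rejection x s hφ D.T).comp hmk)
      fun y => D.rejection_mem_Icc x s hφ hφ1 D.T _
  have hb : (x' i - x i) ^ 2 * (1 / σ) ^ 2 ≤ v := by
    rw [hv, ← mul_pow, mul_one_div, div_pow, div_pow]
    gcongr ?_ / _
    exact sq_le_sq.2 (hx.2.trans (le_abs_self r))
  rw [D.integral_guidedDenoising x s σ hφ hφ1, D.integral_guidedDenoising x' s σ hφ hφ1,
    ← integral_const_mul, ← integral_sub (hI x') ((hI x).const_mul l)]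
  have := integral_mono ((hI x').sub ((hI x).const_mul l))
    (integrable_const (hockeyStick 1 l v)) fun y => by
      have := D.rejection_sub_le_hockeyStick s hx.1 hφ hφ1 (l := l) le_rfl (w := 1) (v := v)
        (p := (y, fun _ => (1 / σ) ^ 2)) (sq_nonneg _) hb
      simpa using this
  simpa using this

end DiffusionModel

/-! ### From hockey-stick divergences to trade-off functions -/

theorem tradeoff_le {Y : Type*} [MeasurableSpace Y] (P Q : ProbabilityMeasure Y) {α : ℝ}
    {φ : Y → ℝ} (hφ : Measurable φ) (hφ1 : ∀ y, φ y ∈ Set.Icc (0 : ℝ) 1)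
    (hα : ∫ y, φ y ∂(P : Measure Y) ≤ α) : tradeoff P Q α ≤ 1 - ∫ y, φ y ∂(Q : Measure Y) := by
  refine csInf_le ⟨0, ?_⟩ ⟨φ, hφ, hφ1, hα, rfl⟩
  rintro _ ⟨ψ, hψ, hψ1, -, rfl⟩
  exact sub_nonneg.2 (integral_mem_Icc hψ hψ1).2

/-- The probability under `N(m, 1)` that the test with threshold `c` rejects: its level for `m = 0`,
and its power against `N(m, 1)` otherwise. -/
noncomputable def thresholdPower (m c : ℝ) : ℝ := (gaussianReal m 1).real (Set.Ioi c)

theorem integral_indicator_Ioi (m c : ℝ) :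
    ∫ y, (Set.Ioi c).indicator 1 y ∂gaussianReal m 1 = thresholdPower m c :=
  integral_indicator_one measurableSet_Ioi

theorem thresholdPower_eq (m c : ℝ) : thresholdPower m c = 1 - cdf (gaussianReal m 1) c := by
  rw [cdf_eq_real, thresholdPower, ← Set.compl_Iic, probReal_compl_eq_one_sub measurableSet_Iic]

theorem tendsto_thresholdPower_atTop (m : ℝ) :
    Filter.Tendsto (thresholdPower m) Filter.atTop (nhds 0) := by
  simp only [funext (thresholdPower_eq m)]
  simpa using (tendsto_cdf_atTop (gaussianReal m 1)).const_sub 1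

theorem tendsto_thresholdPower_atBot (m : ℝ) :
    Filter.Tendsto (thresholdPower m) Filter.atBot (nhds 1) := by
  simp only [funext (thresholdPower_eq m)]
  simpa using (tendsto_cdf_atBot (gaussianReal m 1)).const_sub 1

theorem continuous_thresholdPower (m : ℝ) : Continuous (thresholdPower m) := by
  simp only [funext (thresholdPower_eq m)]
  refine continuous_const.sub (continuous_iff_continuousAt.2 fun c => ?_)
  rw [(cdf (gaussianReal m 1)).mono.continuousAt_iff_leftLim_eq_rightLim,
    StieltjesFunction.rightLim_eq]
  -- A jump of the distribution function would be an atom.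
  have h := (cdf (gaussianReal m 1)).measure_singleton c
  have := nullSingletonClass_gaussianReal (μ := m) (one_ne_zero (α := ℝ≥0))
  rw [measure_cdf, measure_singleton, eq_comm, ENNReal.ofReal_eq_zero] at h
  exact le_antisymm ((cdf (gaussianReal m 1)).mono.leftLim_le le_rfl) (by linarith)

theorem exists_thresholdPower_eq (m : ℝ) {α : ℝ} (hα : α ∈ Set.Ioo (0 : ℝ) 1) :
    ∃ c, thresholdPower m c = α :=
  mem_range_of_exists_le_of_exists_ge (continuous_thresholdPower m)
    (((tendsto_thresholdPower_atTop m).eventually_le_const hα.1).exists)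
    (((tendsto_thresholdPower_atBot m).eventually_const_le hα.2).exists)

/-- The threshold test attains the hockey-stick divergence at the value `l` of the likelihood
ratio at its threshold, because the likelihood ratio is monotone. -/
theorem thresholdPower_sub_eq_hockeyStick {m : ℝ} (hm : 0 ≤ m) (c : ℝ) {v : ℝ≥0}
    (hv : (v : ℝ) = m ^ 2) :
    thresholdPower m c - Real.exp (m * c - v / 2) * thresholdPower 0 c
      = hockeyStick 1 (Real.exp (m * c - v / 2)) v := by
  set l := Real.exp (m * c - v / 2) with hl
  have hψ : Measurable ((Set.Ioi c).indicator (1 : ℝ → ℝ)) :=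
    measurable_one.indicator measurableSet_Ioi
  have hψ1 : ∀ y, (Set.Ioi c).indicator (1 : ℝ → ℝ) y ∈ Set.Icc (0 : ℝ) 1 := fun y => by
    by_cases h : y ∈ Set.Ioi c <;> simp [h]
  have hmap : gaussianReal 0 v = (gaussianReal 0 1).map (fun y => m * y) := by
    rw [gaussianReal_map_const_mul]
    congr 1
    · simp
    · apply NNReal.coe_injective
      simp [hv]
  have hshift : ∫ y, (Set.Ioi c).indicator 1 y ∂gaussianReal m 1 =
      ∫ y, Real.exp (m * y - v / 2) * (Set.Ioi c).indicator 1 y ∂gaussianReal 0 1 := by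
    rw [gaussianReal_eq_withDensity 0 m one_ne_zero, integral_withDensity_eq_integral_toReal_smul
      (by fun_prop) (.of_forall fun _ => ENNReal.ofReal_lt_top)]
    congr 1 with y
    rw [ENNReal.toReal_ofReal (Real.exp_pos _).le, smul_eq_mul, hv]
    simp
  have hexp : Integrable (fun y => Real.exp (m * y - v / 2)) (gaussianReal 0 1) := by
    simpa using integrable_exp_affine_gaussianReal m 0 (v / 2) 0 1
  have hI1 : Integrable (fun y => Real.exp (m * y - v / 2) * (Set.Ioi c).indicator 1 y)
      (gaussianReal 0 1) :=
    hexp.mul_bdd (c := 1) hψ.aestronglyMeasurable (.of_forall fun y => by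
      rw [Real.norm_eq_abs, abs_of_nonneg (hψ1 y).1]; exact (hψ1 y).2)
  have hI2 := (integrable_of_measurable_of_mem_Icc (μ := gaussianReal 0 1) hψ hψ1).const_mul l
  unfold hockeyStick
  rw [← integral_indicator_Ioi, ← integral_indicator_Ioi, hshift, ← integral_const_mul,
    ← integral_sub hI1 hI2, hmap, integral_map (by fun_prop) (by fun_prop)]
  congr 1 with y
  -- Above the threshold the likelihood ratio is at least `l`, below it at most `l`.
  by_cases hy : c < y
  · have h : l ≤ Real.exp (m * y - v / 2) := by rw [hl]; gcongr
    rw [Set.indicator_of_mem (Set.mem_Ioi.2 hy), max_eq_left (by linarith)]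
    simp
  · have h : Real.exp (m * y - v / 2) ≤ l := by rw [hl]; gcongr; exact not_lt.1 hy
    rw [Set.indicator_of_notMem (by simpa using hy), max_eq_right (by linarith)]
    simp

/-- If every test separates `P` from `Q` at most as well as the hockey-stick divergences of a
Gaussian shift by `m ≥ 0` allow, then the trade-off function of `P` and `Q` is at least that of the
shift. -/
theorem gaussianTradeoff_le_tradeoff {Y : Type*} [MeasurableSpace Y] {P Q : ProbabilityMeasure Y}
    {m : ℝ} (hm : 0 ≤ m) {v : ℝ≥0} (hv : (v : ℝ) = m ^ 2)
    (h : ∀ φ : Y → ℝ, Measurable φ → (∀ y, φ y ∈ Set.Icc (0 : ℝ) 1) → ∀ l : ℝ,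
      ∫ y, φ y ∂(Q : Measure Y) - l * ∫ y, φ y ∂(P : Measure Y) ≤ hockeyStick 1 l v)
    {α : ℝ} (hα : α ∈ Set.Icc (0 : ℝ) 1) : gaussianTradeoff m α ≤ tradeoff P Q α := by
  refine le_csInf ⟨_, 0, measurable_const, by simp, by simpa using hα.1, rfl⟩ ?_
  rintro _ ⟨φ, hφ, hφ1, hφα, rfl⟩
  -- Every threshold test whose level is at least that of `φ` is at least as powerful as `φ`.
  have key : ∀ c, ∫ y, φ y ∂(P : Measure Y) ≤ thresholdPower 0 c →
      ∫ y, φ y ∂(Q : Measure Y) ≤ thresholdPower m c := fun c hc => by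
    have h1 := h φ hφ hφ1 (Real.exp (m * c - v / 2))
    rw [← thresholdPower_sub_eq_hockeyStick hm c hv] at h1
    linarith [mul_le_mul_of_nonneg_left hc (Real.exp_pos (m * c - v / 2)).le]
  have hQ := integral_mem_Icc (μ := (Q : Measure Y)) hφ hφ1
  have hP := integral_mem_Icc (μ := (P : Measure Y)) hφ hφ1
  rcases hα.1.eq_or_lt with h0 | h0
  · -- At level `0` the power of `φ` is below that of every threshold test, hence `0`.
    have hQ0 : ∫ y, φ y ∂(Q : Measure Y) ≤ 0 :=
      ge_of_tendsto' (tendsto_thresholdPower_atTop m) fun c =>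
        key c ((hφα.trans h0.symm.le).trans measureReal_nonneg)
    refine (tradeoff_le (unitNormal 0) (unitNormal m) (φ := 0) measurable_const (by simp)
      (by simpa using hα.1)).trans ?_
    simpa using hQ0
  rcases hα.2.eq_or_lt with h1 | h1
  · refine (tradeoff_le (unitNormal 0) (unitNormal m) (φ := 1) measurable_const (by simp)
      (by simp [h1])).trans ?_
    simpa using hQ.2
  · obtain ⟨c, hc⟩ := exists_thresholdPower_eq 0 ⟨h0, h1⟩
    refine (tradeoff_le (unitNormal 0) (unitNormal m) (φ := (Set.Ioi c).indicator 1)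
      (measurable_one.indicator measurableSet_Ioi)
      (fun y => by by_cases h : y ∈ Set.Ioi c <;> simp [h])
      ((integral_indicator_Ioi 0 c).trans hc).le).trans ?_
    have := key c (hφα.trans hc.ge)
    change 1 - ∫ y, (Set.Ioi c).indicator 1 y ∂gaussianReal m 1 ≤ _
    rw [integral_indicator_Ioi]
    linarith

theorem mainTheorem2 {d : ℕ} (D : DiffusionModel d) (s σ : ℝ) (hσ : 0 < σ)
    (i : Fin d) (r : ℝ) (hr : 0 ≤ r) :
    IsGDP (PixelNeighbours i r) (D.guidedDenoising s σ) (r / σ) := by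
  intro x x' hx α hα
  exact gaussianTradeoff_le_tradeoff (v := ⟨(r / σ) ^ 2, sq_nonneg _⟩) (div_nonneg hr hσ.le) rfl
    (fun φ hφ hφ1 l => D.guidedDenoising_sub_le_hockeyStick s σ hx hφ hφ1 l rfl) hα
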